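/- Let $T$ be a text over the alphabet $[1..\sigma]$, and let $n=|T|+1$ be its length together with an end marker $\$$ that is smaller than all characters. The $n$ suffixes of $T$ (the empty one included, which has rank $1$) are ranked lexicographically. The interval of a string $p$ is the interval of ranks of the suffixes that have $p$ as a prefix, and the pair of $p$ consists of the interval of $p$ in $T$ and the interval of the reversed string $\overline p$ in the reversed text $\overline T$. A factor $p$ is left-maximal if $ap$ and $bp$ appear in $\$T$ for two distinct characters $a,b$ (possibly $\$$). A bidirectional text index on $T$ answers the following queries, in time $t\ge 1$ each: reading an entry of the Burrows–Wheeler transform of $T$; $\mathtt{extendleft}$, which takes the pair of a factor $p$ and a character $c\in[1..\sigma]$ to the pair of $cp$; and $\mathtt{contractright}$, which takes the pair of a left-maximal factor $pc$, $c$ a character, to the pair of $p$. For a text position $0\le i<|T|$, let $\mathrm{PLCP}[i]$ be the length of the longest common prefix of the suffix of $T$ that starts at $i$, say of rank $r$, and the suffix of rank $r-1$. Lemma. There is one fixed program for a unit-cost word RAM with word size $w=\Theta(\log n)$ (where $n,\sigma<2^w$ and $w\le C(\log_2 n+1)$) such that for every such text, given a bidirectional text index on $T$ that is accessed only through the queries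 above, the program builds the PLCP array of $T$ in $O(t\cdot n)$ time and with $O(n)$ bits of space in addition to the index. The constants depend only on $C$. The array is produced within this space, as a bit vector whose one-bits stand at the places $\mathrm{PLCP}[i]+2i$, exactly $i$ one-bits preceding the place $\mathrm{PLCP}[i]+2i$ (so $\mathrm{PLCP}[i]=\mathrm{select}(i)-2i$, with $\mathrm{select}(i)$ the place of the one-bit that is preceded by exactly $i$ one-bits). -/

import Mathlib

/-! Texts, suffix arrays, the Burrows-Wheeler transform, the permuted lcp array, the navigation
operations of a bidirectional text index, and a word RAM that has access to such an index.

A text is a list of characters, and characters are natural numbers `1, ..., σ`. The number `0` codes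
the end marker `$`. A text with `m` characters has `n = m + 1` suffixes, counting the empty one.
Text positions are counted from `0`; ranks are counted from `1`, as in `[1..n]`. -/

namespace TextIndex

section Strings

/-- The number `n` of suffixes of the text `T`, the empty suffix included, which is the length of
the text together with its end marker. -/
def size (T : List ℕ) : ℕ := T.length + 1

/-- The suffix array: the starting positions of all suffixes (the empty one included), listed in
lexicographic order of the suffixes. In the order of lists a proper prefix comes first, which is
the order obtained from an end marker that is smaller than all characters. -/
def suffixArray (T : List ℕ) : List ℕ :=
  (List.range (size T)).mergeSort (fun i j => decide (T.drop i ≤ T.drop j))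

/-- The starting position of the suffix of rank `r`, for `1 ≤ r ≤ n`. -/
def suffixPos (T : List ℕ) (r : ℕ) : ℕ := (suffixArray T).getD (r - 1) 0

/-- The rank (in `[1..n]`) of the suffix that starts at position `i`, for `i ≤ m`. -/
def rank (T : List ℕ) (i : ℕ) : ℕ := (suffixArray T).idxOf i + 1

/-- The Burrows-Wheeler transform, for `1 ≤ r ≤ n`: the character that precedes the suffix of
rank `r`, and the end marker `0` if that suffix is the whole text. -/
def bwt (T : List ℕ) (r : ℕ) : ℕ :=
  if suffixPos T r = 0 then 0 else T.getD (suffixPos T r - 1) 0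

/-- The length of the longest common prefix of two strings. -/
def lcp : List ℕ → List ℕ → ℕ
  | a :: u, b :: v => if a = b then lcp u v + 1 else 0
  | _, _ => 0

/-- The permuted lcp array: entry `i < m` is the length of the longest common prefix of the suffix
that starts at position `i`, say of rank `r`, and the suffix of rank `r - 1`. A nonempty suffix has
rank at least `2`, since the empty suffix has rank `1`. -/
def plcp (T : List ℕ) (i : ℕ) : ℕ :=
  lcp (T.drop i) (T.drop (suffixPos T (rank T i - 1)))

/-- The suffix array interval `[lo, hi]` of a string `p`: the smallest and the largest rank of a
suffix that has `p` as a prefix. It is `(1, 0)`, an empty interval, if `p` does not occur. -/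
def interval (T p : List ℕ) : ℕ × ℕ :=
  let L := (List.range' 1 (size T)).filter (fun r => decide (p <+: T.drop (suffixPos T r)))
  (L.headD 1, L.getLastD 0)

/-- The pair of intervals of `p`: its suffix array interval in the text, and the suffix array
interval of the reversed string in the reversed text. -/
def intervalPair (T p : List ℕ) : (ℕ × ℕ) × (ℕ × ℕ) :=
  (interval T p, interval T.reverse p.reverse)

/-- All factors of the text (with repetitions). -/
def factors (T : List ℕ) : List (List ℕ) := T.tails.flatMap List.inits

/-- `p` is left-maximal if `ap` and `bp` appear in `$T` for two distinct characters `a` and `b`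
(one of which may be the marker `$`). -/
def LeftMaximal (T p : List ℕ) : Prop :=
  ∃ a ∈ 0 :: T, ∃ b ∈ 0 :: T, a ≠ b ∧ (a :: p) <:+: (0 :: T) ∧ (b :: p) <:+: (0 :: T)

instance (T p : List ℕ) : Decidable (LeftMaximal T p) := by
  unfold LeftMaximal; infer_instance

/-- The factor of the text with the given pair of intervals, if there is one. There is at most one:
the first interval determines where the factor starts, and the second where it ends. -/
def factorOf (T : List ℕ) (q : (ℕ × ℕ) × (ℕ × ℕ)) : Option (List ℕ) :=
  (factors T).find? (fun p => decide (intervalPair T p = q))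

/-- `extendleft`: from the pair of intervals of a factor `p` and a character `c` of the alphabet
`[1..σ]` to the pair of intervals of `cp` (two empty intervals if `cp` does not occur). It is
undefined if its argument is not the pair of a factor or `c` is not in the alphabet. -/
def extendLeft (σ : ℕ) (T : List ℕ) (q : (ℕ × ℕ) × (ℕ × ℕ)) (c : ℕ) :
    Option ((ℕ × ℕ) × (ℕ × ℕ)) :=
  if 1 ≤ c ∧ c ≤ σ then (factorOf T q).map (fun p => intervalPair T (c :: p)) else none

/-- `contractright`: from the pair of intervals of a left-maximal factor `pc`, where `c` is a
character, to the pair of intervals of `p`. It is undefined on any other argument. -/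
def contractRight (T : List ℕ) (q : (ℕ × ℕ) × (ℕ × ℕ)) : Option ((ℕ × ℕ) × (ℕ × ℕ)) :=
  (factorOf T q).bind fun p =>
    if p ≠ [] ∧ LeftMaximal T p then some (intervalPair T p.dropLast) else none

end Strings

section Machine

/-- The arithmetic and logic operations of the machine. -/
inductive BinOp
  | add | sub | mul | div | mod | and | or | xor | shiftLeft | shiftRight

/-- The values of the operations on words of `w` bits, before reduction modulo `2 ^ w`. -/
def BinOp.eval (w : ℕ) : BinOp → ℕ → ℕ → ℕ
  | .add, x, y => x + y
  | .sub, x, y => x + 2 ^ w - y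
  | .mul, x, y => x * y
  | .div, x, y => x / y
  | .mod, x, y => x % y
  | .and, x, y => x &&& y
  | .or, x, y => x ||| y
  | .xor, x, y => x ^^^ y
  | .shiftLeft, x, y => x <<< y
  | .shiftRight, x, y => x >>> y

/-- Four registers (out of `k`) that hold a pair of intervals. -/
structure PairRegs (k : ℕ) where
  lo : Fin k
  hi : Fin k
  lo' : Fin k
  hi' : Fin k

/-- The instructions of a word RAM with `k` registers that has access to a bidirectional index. -/
inductive Instr (k : ℕ)
  /-- Put the constant `c` (modulo `2 ^ w`) into register `d`. -/
  | const (d : Fin k) (c : ℕ)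
  /-- Put the result of the operation on registers `a` and `b` into register `d`. -/
  | op (o : BinOp) (d a b : Fin k)
  /-- Put the memory cell whose address is in register `a` into register `d`. -/
  | load (d a : Fin k)
  /-- Put register `b` into the memory cell whose address is in register `a`. -/
  | store (a b : Fin k)
  /-- Go to instruction `l` if register `a` is equal to register `b`. -/
  | jumpEq (a b : Fin k) (l : ℕ)
  /-- Go to instruction `l` if register `a` is less than register `b`. -/
  | jumpLt (a b : Fin k) (l : ℕ)
  /-- Index query: put `bwt[r]` into register `d`, where `r` is in register `a`. -/
  | readBwt (d a : Fin k)
  /-- Index query: `extendleft` of the pair in `q` by the character in register `c`, into `d`. -/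
  | extendLeft (d q : PairRegs k) (c : Fin k)
  /-- Index query: `contractright` of the pair in `q`, into `d`. -/
  | contractRight (d q : PairRegs k)

/-- The cost of an instruction: an index query costs `t`, anything else is one step. -/
def Instr.cost {k : ℕ} (t : ℕ) : Instr k → ℕ
  | .readBwt _ _ => t
  | .extendLeft _ _ _ => t
  | .contractRight _ _ => t
  | _ => 1

/-- A configuration: program counter, registers, memory cells. -/
structure State (k : ℕ) where
  pc : ℕ
  reg : Fin k → ℕ
  mem : ℕ → ℕ

/-- Write the value `v`, reduced to a word of `w` bits, into register `d`. -/
def State.setReg {k : ℕ} (w : ℕ) (s : State k) (d : Fin k) (v : ℕ) : State k :=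
  { s with reg := Function.update s.reg d (v % 2 ^ w) }

/-- Go to instruction `l`. -/
def State.goto {k : ℕ} (s : State k) (l : ℕ) : State k := { s with pc := l }

/-- Go to the following instruction. -/
def State.next {k : ℕ} (s : State k) : State k := s.goto (s.pc + 1)

/-- The pair of intervals held by four registers. -/
def State.getPair {k : ℕ} (s : State k) (q : PairRegs k) : (ℕ × ℕ) × (ℕ × ℕ) :=
  ((s.reg q.lo, s.reg q.hi), (s.reg q.lo', s.reg q.hi'))

/-- Write a pair of intervals into four registers. -/
def State.setPair {k : ℕ} (w : ℕ) (s : State k) (d : PairRegs k) (v : (ℕ × ℕ) × (ℕ × ℕ)) :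
    State k :=
  (((s.setReg w d.lo v.1.1).setReg w d.hi v.1.2).setReg w d.lo' v.2.1).setReg w d.hi' v.2.2

/-- The effect of one instruction on a machine with word size `w` and memory cells `0, ..., S - 1`,
with access to an index on the text `T` over the alphabet `[1..σ]`. A memory access outside these
cells and an index query that is undefined are faults (`none`). -/
def Instr.exec {k : ℕ} (w S σ : ℕ) (T : List ℕ) (s : State k) : Instr k → Option (State k)
  | .const d c => some (s.setReg w d c).next
  | .op o d a b => some (s.setReg w d (o.eval w (s.reg a) (s.reg b))).next
  | .load d a => if s.reg a < S then some (s.setReg w d (s.mem (s.reg a))).next else none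
  | .store a b =>
      if s.reg a < S then
        some { s with mem := Function.update s.mem (s.reg a) (s.reg b) }.next
      else none
  | .jumpEq a b l => some (if s.reg a = s.reg b then s.goto l else s.next)
  | .jumpLt a b l => some (if s.reg a < s.reg b then s.goto l else s.next)
  | .readBwt d a =>
      if 1 ≤ s.reg a ∧ s.reg a ≤ size T then some (s.setReg w d (bwt T (s.reg a))).next else none
  | .extendLeft d q c =>
      (TextIndex.extendLeft σ T (s.getPair q) (s.reg c)).map fun v => (s.setPair w d v).next
  | .contractRight d q =>
      (TextIndex.contractRight T (s.getPair q)).map fun v => (s.setPair w d v).next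

/-- The initial configuration: the first registers hold `n`, the word size and the alphabet size,
the other registers and all memory cells hold `0`. -/
def State.init (k w σ : ℕ) (T : List ℕ) : State k where
  pc := 0
  reg r := if r.val = 0 then size T else if r.val = 1 then w else if r.val = 2 then σ else 0
  mem _ := 0

/-- `Halts w S σ t T P s τ s'`: started in `s`, the program `P` halts without a fault in the
configuration `s'`, and the total cost of the executed instructions is `τ`. The program halts when
the program counter leaves it. -/
inductive Halts {k : ℕ} (w S σ t : ℕ) (T : List ℕ) (P : List (Instr k)) :
    State k → ℕ → State k → Prop
  | halt (s : State k) : P.length ≤ s.pc → Halts w S σ t T P s 0 s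
  | step (i : Instr k) (s s₁ s' : State k) (τ : ℕ) : P[s.pc]? = some i →
      i.exec w S σ T s = some s₁ → Halts w S σ t T P s₁ τ s' →
      Halts w S σ t T P s (i.cost t + τ) s'

/-- Bit number `x` of a memory with cells of `w` bits. -/
def memBit (w : ℕ) (mem : ℕ → ℕ) (x : ℕ) : Bool := (mem (x / w)).testBit (x % w)

/-- The memory holds the permuted lcp array of `T` in its bit vector encoding: for every text
position `i` (counted from `0`), the one-bit that is preceded by exactly `i` one-bits stands at
place `plcp T i + 2 * i`, so that the entry is `select(i) - 2 * i`. -/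
def HoldsPlcp (w : ℕ) (mem : ℕ → ℕ) (T : List ℕ) : Prop :=
  ∀ i < T.length, memBit w mem (plcp T i + 2 * i) = true ∧
    ((Finset.range (plcp T i + 2 * i)).filter (fun x => memBit w mem x = true)).card = i

end Machine

end TextIndex

/-! The text is scanned from right to left. For the current position `i`, two pairs are kept: that
of the whole suffix, and that of the match, its prefix of length `plcp T i`. Every string that has
the suffix as a prefix is at least as large, so the lower bound of the suffix's interval is its rank
(`interval_drop_fst`). The BWT entry at that rank is the character `c` to prepend next, or the
marker at the start of the text.

Stepping from `i + 1` to `i`, the entry grows by at most one (`plcp_le_plcp_succ_add_one`). The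
candidates are therefore `c` followed by a prefix of the old match, tried from the longest down. A
candidate starts a suffix smaller than suffix `i` exactly if the lower bound of its interval is
below the rank of `i` (`interval_fst_lt_rank_iff`), so one `extendleft` decides it. After a failure
the match is shortened by `contractright`. That query is defined: the match also starts a smaller
suffix, and there it cannot be preceded by `c`, since otherwise the candidate would have succeeded.
Hence the match is left-maximal (`leftMaximal_of_rank_le`).

No length is ever stored. The match is empty if and only if its lower bound is `1`
(`interval_fst_eq_one_iff`), and the place in the bit vector serves as a counter. It starts at twice
the text length and drops by one with each trial, and once more when even the single character `c`
fails; this leaves it at `plcp T i + 2 * i` when position `i` is settled. The place is also the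
potential that bounds the running time: the number of trials is at most twice the text length
(`haltsWithin_place`). -/

namespace TextIndex

/-! ### The suffix array and the order of the suffixes. -/

section Ranks

/-- Convexity in lexicographic order; this is why the occurrences of a string fill a whole interval
of ranks. -/
theorem prefix_of_le_of_le {p a x b : List ℕ} (ha : p <+: a) (hb : p <+: b) (hax : a ≤ x)
    (hxb : x ≤ b) : p <+: x := by
  induction p generalizing a x b with
  | nil => exact List.nil_prefix
  | cons c p ih =>
    obtain ⟨u, rfl⟩ := ha
    obtain ⟨v, rfl⟩ := hb
    cases x with
    | nil => exact absurd (List.nil_lt_cons c (p ++ u)) (not_lt.2 hax)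
    | cons d x =>
      have h1 : ¬ (d :: x) < c :: (p ++ u) := not_lt.2 hax
      have h2 : ¬ c :: (p ++ v) < d :: x := not_lt.2 hxb
      simp only [List.cons_lt_cons_iff, not_or, not_and] at h1 h2
      obtain rfl : c = d := by omega
      exact List.cons_prefix_cons.2 ⟨rfl, ih (List.prefix_append p u) (List.prefix_append p v)
        (not_lt.1 (h1.2 rfl)) (not_lt.1 (h2.2 rfl))⟩

theorem le_of_prefix {p a : List ℕ} (h : p <+: a) : p ≤ a := by
  induction p generalizing a with
  | nil => exact not_lt.1 (List.not_lt_nil a)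
  | cons c p ih =>
    obtain ⟨u, rfl⟩ := h
    refine not_lt.1 ?_
    rw [List.cons_append, List.cons_lt_cons_iff]
    rintro (h | ⟨-, h⟩)
    · exact lt_irrefl _ h
    · exact not_lt.2 (ih (List.prefix_append p u)) h

theorem length_suffixArray (T : List ℕ) : (suffixArray T).length = size T := by
  simp [suffixArray]

theorem mem_suffixArray {T : List ℕ} {i : ℕ} : i ∈ suffixArray T ↔ i ≤ T.length := by
  simp [suffixArray, size]

theorem nodup_suffixArray (T : List ℕ) : (suffixArray T).Nodup :=
  (List.mergeSort_perm _ _).nodup_iff.2 List.nodup_range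

theorem pairwise_suffixArray (T : List ℕ) :
    (suffixArray T).Pairwise fun i j => T.drop i ≤ T.drop j := by
  have := List.pairwise_mergeSort (le := fun i j => decide (T.drop i ≤ T.drop j))
    (fun a b c => by simpa using le_trans) (fun a b => by simpa using le_total _ _)
    (List.range (size T))
  simpa [suffixArray] using this

theorem suffixPos_eq_getElem {T : List ℕ} {r : ℕ} (h1 : 1 ≤ r) (h2 : r ≤ size T) :
    suffixPos T r = (suffixArray T)[r - 1]'(by rw [length_suffixArray]; omega) := by
  rw [suffixPos, List.getD_eq_getElem]

theorem suffixPos_le {T : List ℕ} {r : ℕ} (h1 : 1 ≤ r) (h2 : r ≤ size T) :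
    suffixPos T r ≤ T.length := by
  rw [suffixPos_eq_getElem h1 h2]
  exact mem_suffixArray.1 (List.getElem_mem _)

theorem one_le_rank (T : List ℕ) (i : ℕ) : 1 ≤ rank T i := Nat.le_add_left _ _

theorem rank_le {T : List ℕ} {i : ℕ} (hi : i ≤ T.length) : rank T i ≤ size T := by
  have := List.idxOf_lt_length_iff.2 (mem_suffixArray.2 hi)
  rw [length_suffixArray] at this
  exact this

theorem suffixPos_rank {T : List ℕ} {i : ℕ} (hi : i ≤ T.length) :
    suffixPos T (rank T i) = i := by
  rw [suffixPos_eq_getElem (one_le_rank T i) (rank_le hi)]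
  exact List.getElem_idxOf _

theorem rank_suffixPos {T : List ℕ} {r : ℕ} (h1 : 1 ≤ r) (h2 : r ≤ size T) :
    rank T (suffixPos T r) = r := by
  rw [rank, suffixPos_eq_getElem h1 h2, (nodup_suffixArray T).idxOf_getElem]
  omega

theorem drop_suffixPos_le {T : List ℕ} {r s : ℕ} (h1 : 1 ≤ r) (h : r ≤ s) (h2 : s ≤ size T) :
    T.drop (suffixPos T r) ≤ T.drop (suffixPos T s) := by
  rcases h.eq_or_lt with rfl | h
  · exact le_rfl
  · rw [suffixPos_eq_getElem h1 (by omega), suffixPos_eq_getElem (by omega) h2]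
    exact List.pairwise_iff_getElem.1 (pairwise_suffixArray T) _ _ _ _ (by omega)

theorem rank_lt_rank {T : List ℕ} {i j : ℕ} (hi : i ≤ T.length) (hj : j ≤ T.length)
    (h : T.drop i < T.drop j) : rank T i < rank T j := by
  by_contra hle
  have := drop_suffixPos_le (one_le_rank T j) (not_lt.1 hle) (rank_le hi)
  rw [suffixPos_rank hi, suffixPos_rank hj] at this
  exact not_lt.2 this h

theorem drop_lt_of_rank_lt {T : List ℕ} {i j : ℕ} (hi : i ≤ T.length) (hj : j ≤ T.length)
    (h : rank T i < rank T j) : T.drop i < T.drop j := by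
  have := drop_suffixPos_le (one_le_rank T i) h.le (rank_le hj)
  rw [suffixPos_rank hi, suffixPos_rank hj] at this
  refine lt_of_le_of_ne this fun he => ?_
  have := congrArg List.length he
  simp only [List.length_drop] at this
  obtain rfl : i = j := by omega
  exact lt_irrefl _ h

end Ranks

/-! ### Intervals, the pair as a faithful name of a factor, and the values of the queries. -/

section Intervals

theorem interval_spec {T p : List ℕ} {i : ℕ} (hi : i ≤ T.length) (hp : p <+: T.drop i) :
    1 ≤ (interval T p).1 ∧ (interval T p).2 ≤ size T ∧
    (∀ r, 1 ≤ r → r ≤ size T →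
      (p <+: T.drop (suffixPos T r) ↔ (interval T p).1 ≤ r ∧ r ≤ (interval T p).2)) := by
  set L := (List.range' 1 (size T)).filter
    (fun r => decide (p <+: T.drop (suffixPos T r))) with hL
  have hmem : ∀ r, r ∈ L ↔ (1 ≤ r ∧ r ≤ size T) ∧ p <+: T.drop (suffixPos T r) := by
    intro r
    simp only [hL, List.mem_filter, List.mem_range'_1, decide_eq_true_eq]
    constructor <;> rintro ⟨h, h'⟩ <;> exact ⟨by omega, h'⟩
  have hne : L ≠ [] := List.ne_nil_of_mem ((hmem (rank T i)).2
    ⟨⟨one_le_rank T i, rank_le hi⟩, by rwa [suffixPos_rank hi]⟩)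
  have hs : L.Pairwise (· < ·) := (List.pairwise_lt_range' 1).filter _
  have e1 : (interval T p).1 = L.head hne := by
    change L.headD 1 = _
    rw [List.headD_eq_head?_getD, List.head?_eq_some_head hne]; rfl
  have e2 : (interval T p).2 = L.getLast hne := by
    change L.getLastD 0 = _
    rw [List.getLastD_eq_getLast?, List.getLast?_eq_some_getLast hne]; rfl
  have m1 := (hmem _).1 (List.head_mem hne)
  have m2 := (hmem _).1 (List.getLast_mem hne)
  rw [e1, e2]
  refine ⟨m1.1.1, m2.1.2, fun r h1 h2 => ⟨fun h => ?_, fun h => ?_⟩⟩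
  · have hr := (hmem r).2 ⟨⟨h1, h2⟩, h⟩
    obtain ⟨k, hk, rfl⟩ := List.getElem_of_mem hr
    have hs' := List.pairwise_iff_getElem.1 hs
    rw [List.head_eq_getElem, List.getLast_eq_getElem]
    constructor
    · rcases Nat.eq_zero_or_pos k with rfl | hk0
      · exact le_rfl
      · exact (hs' 0 k _ _ hk0).le
    · rcases (Nat.le_sub_one_of_lt hk).eq_or_lt with h | h
      · simp [h]
      · exact (hs' _ _ _ _ h).le
  · exact prefix_of_le_of_le m1.2 m2.2 (drop_suffixPos_le m1.1.1 h.1 h2)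
      (drop_suffixPos_le h1 h.2 m2.1.2)

theorem prefix_drop_iff {T p : List ℕ} {i j : ℕ} (hi : i ≤ T.length) (hp : p <+: T.drop i)
    (hj : j ≤ T.length) :
    p <+: T.drop j ↔ (interval T p).1 ≤ rank T j ∧ rank T j ≤ (interval T p).2 := by
  have := (interval_spec hi hp).2.2 (rank T j) (one_le_rank T j) (rank_le hj)
  rwa [suffixPos_rank hj] at this

theorem interval_fst_le_rank {T p : List ℕ} {i : ℕ} (hi : i ≤ T.length) (hp : p <+: T.drop i) :
    (interval T p).1 ≤ rank T i := ((prefix_drop_iff hi hp hi).1 hp).1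

theorem interval_snd_le (T p : List ℕ) : (interval T p).2 ≤ size T := by
  change ((List.range' 1 (size T)).filter
    (fun r => decide (p <+: T.drop (suffixPos T r)))).getLastD 0 ≤ _
  rw [List.getLastD_eq_getLast?]
  cases h : (List.filter _ _).getLast? with
  | none => exact Nat.zero_le _
  | some a =>
    have := List.mem_of_getLast? h
    simp only [List.mem_filter, List.mem_range'_1] at this
    simp only [Option.getD_some]
    omega

theorem interval_fst_le (T p : List ℕ) : (interval T p).1 ≤ size T := by
  change ((List.range' 1 (size T)).filter
    (fun r => decide (p <+: T.drop (suffixPos T r)))).headD 1 ≤ _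
  rw [List.headD_eq_head?_getD]
  cases h : (List.filter _ _).head? with
  | none => exact Nat.le_add_left _ _
  | some a =>
    have := List.mem_of_mem_head? h
    simp only [List.mem_filter, List.mem_range'_1] at this
    simp only [Option.getD_some]
    omega

/-- Any suffix that extends suffix `i` is lexicographically at least as large, so suffix `i` comes
first in its own interval. The program can thus read the rank off the pair. -/
theorem interval_drop_fst {T : List ℕ} {i : ℕ} (hi : i ≤ T.length) :
    (interval T (T.drop i)).1 = rank T i := by
  have hs := interval_spec hi (List.prefix_refl (T.drop i))
  have hle := interval_fst_le_rank hi (List.prefix_refl (T.drop i))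
  refine le_antisymm hle (not_lt.1 fun hlt => ?_)
  have h2 := interval_fst_le T (T.drop i)
  have hh := (prefix_drop_iff hi (List.prefix_refl (T.drop i)) hi).1 (List.prefix_refl _)
  have h3 := le_of_prefix ((hs.2.2 _ hs.1 h2).2 ⟨le_rfl, by omega⟩)
  rw [← rank_suffixPos hs.1 h2] at hlt
  exact not_lt.2 h3 (drop_lt_of_rank_lt (suffixPos_le hs.1 h2) hi hlt)

theorem interval_nil (T : List ℕ) : interval T [] = (1, size T) := by
  have hs := interval_spec (T := T) (p := []) (Nat.zero_le _) List.nil_prefix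
  have h1 := (hs.2.2 1 le_rfl (Nat.le_add_left _ _)).1 List.nil_prefix
  have h2 := (hs.2.2 (size T) (Nat.le_add_left _ _) le_rfl).1 List.nil_prefix
  ext <;> dsimp only <;> omega

theorem rank_length (T : List ℕ) : rank T T.length = 1 := by
  rw [← interval_drop_fst le_rfl, List.drop_length, interval_nil]

theorem one_lt_rank {T : List ℕ} {i : ℕ} (hi : i < T.length) : 1 < rank T i := by
  rw [← rank_length T]
  refine rank_lt_rank le_rfl hi.le ?_
  rw [List.drop_length]
  cases h : T.drop i with
  | nil => rw [List.drop_eq_nil_iff] at h; omega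
  | cons a l => exact List.nil_lt_cons a l

/-- Factors with the same interval start at the same positions. -/
theorem prefix_of_interval_eq {T p p' : List ℕ} {i i' : ℕ} (hi : i ≤ T.length)
    (hp : p <+: T.drop i) (hi' : i' ≤ T.length) (hp' : p' <+: T.drop i')
    (h : interval T p = interval T p') {j : ℕ} (hj : j ≤ T.length) :
    p <+: T.drop j ↔ p' <+: T.drop j := by
  rw [prefix_drop_iff hi hp hj, prefix_drop_iff hi' hp' hj, h]

/-- Reversal turns the end of an occurrence into a start, so the second interval of a pair records
where the occurrences end. -/
theorem reverse_prefix_iff {T p : List ℕ} {i : ℕ} (hi : i ≤ T.length) :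
    p.reverse <+: T.reverse.drop (T.length - i) ↔ p <:+ T.take i := by
  rw [List.drop_reverse, List.reverse_prefix, Nat.sub_sub_self hi]

theorem suffix_take_iff {T p : List ℕ} {e : ℕ} (he : e ≤ T.length) :
    p <:+ T.take e ↔ p.length ≤ e ∧ p <+: T.drop (e - p.length) := by
  rw [List.suffix_iff_eq_drop, List.prefix_iff_eq_take, List.length_take, min_eq_left he,
    List.drop_take]
  constructor
  · intro h
    have hl := congrArg List.length h
    simp only [List.length_take, List.length_drop] at hl
    have : p.length ≤ e := by omega
    rw [Nat.sub_sub_self this] at h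
    exact ⟨this, h⟩
  · rintro ⟨h1, h2⟩
    rwa [Nat.sub_sub_self h1]

/-- The leftmost occurrence of `p'` ends where `p` ends, and there `p` cannot start earlier. -/
theorem length_le_of_intervalPair_eq {T p p' : List ℕ} {i i' : ℕ} (hi : i ≤ T.length)
    (hp : p <+: T.drop i) (hi' : i' ≤ T.length) (hp' : p' <+: T.drop i')
    (h : intervalPair T p = intervalPair T p') : p.length ≤ p'.length := by
  classical
  have hs : ∀ j ≤ T.length, (p <+: T.drop j ↔ p' <+: T.drop j) := fun j hj =>
    prefix_of_interval_eq hi hp hi' hp' (congrArg Prod.fst h) hj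
  have hlen : ∀ {q : List ℕ} {j : ℕ}, j ≤ T.length → q <+: T.drop j → j + q.length ≤ T.length := by
    intro q j hj hq
    have := hq.length_le
    rw [List.length_drop] at this
    omega
  have hend : ∀ {q : List ℕ} {j : ℕ}, j ≤ T.length → q <+: T.drop j →
      q.reverse <+: T.reverse.drop (T.length - (j + q.length)) := by
    intro q j hj hq
    rw [reverse_prefix_iff (hlen hj hq), suffix_take_iff (hlen hj hq), Nat.add_sub_cancel]
    exact ⟨Nat.le_add_left _ _, hq⟩
  have he : ∀ e ≤ T.length, (p <:+ T.take e ↔ p' <:+ T.take e) := by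
    intro e he
    rw [← reverse_prefix_iff he, ← reverse_prefix_iff he]
    exact prefix_of_interval_eq (by simp) (hend hi hp) (by simp) (hend hi' hp')
      (congrArg Prod.snd h) (by simp)
  have hex : ∃ j, j ≤ T.length ∧ p <+: T.drop j := ⟨i, hi, hp⟩
  set j := Nat.find hex
  obtain ⟨hj, hpj⟩ : j ≤ T.length ∧ p <+: T.drop j := Nat.find_spec hex
  have hpj' := (hs j hj).1 hpj
  have h1 := hlen hj hpj'
  have h2 := (suffix_take_iff h1).1
    ((he _ h1).2 ((suffix_take_iff h1).2 ⟨by omega, by rwa [Nat.add_sub_cancel]⟩))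
  have := Nat.find_min' hex ⟨by omega, h2.2⟩
  change j ≤ _ at this
  omega

/-- Both strings start at position `i`, by the first intervals, and neither is longer than the
other. Hence the index queries, which see only pairs, act on well-defined factors. -/
theorem eq_of_intervalPair_eq {T p p' : List ℕ} {i i' : ℕ} (hi : i ≤ T.length)
    (hp : p <+: T.drop i) (hi' : i' ≤ T.length) (hp' : p' <+: T.drop i')
    (h : intervalPair T p = intervalPair T p') : p = p' := by
  have h1 := (prefix_of_interval_eq hi hp hi' hp' (congrArg Prod.fst h) hi).1 hp
  refine (List.prefix_of_prefix_length_le hp h1 ?_).eq_of_length_le ?_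
  · exact length_le_of_intervalPair_eq hi hp hi' hp' h
  · exact length_le_of_intervalPair_eq hi' hp' hi hp h.symm

theorem mem_factors {T p : List ℕ} : p ∈ factors T ↔ ∃ i ≤ T.length, p <+: T.drop i := by
  simp only [factors, List.mem_flatMap, List.mem_tails, List.mem_inits]
  constructor
  · rintro ⟨a, ha, hp⟩
    rw [List.suffix_iff_eq_drop] at ha
    exact ⟨_, Nat.sub_le _ _, ha ▸ hp⟩
  · rintro ⟨i, -, hp⟩
    exact ⟨_, List.drop_suffix i T, hp⟩

theorem factorOf_intervalPair {T p : List ℕ} {i : ℕ} (hi : i ≤ T.length) (hp : p <+: T.drop i) :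
    factorOf T (intervalPair T p) = some p := by
  have hm : p ∈ factors T := mem_factors.2 ⟨i, hi, hp⟩
  cases h : factorOf T (intervalPair T p) with
  | none =>
    have := List.find?_eq_none.1 h p hm
    simp at this
  | some q =>
    have h1 := List.find?_some h
    obtain ⟨j, hj, hq⟩ := mem_factors.1 (List.mem_of_find?_eq_some h)
    rw [eq_of_intervalPair_eq hj hq hi hp (by simpa using h1)]

theorem extendLeft_intervalPair {T p : List ℕ} {σ c i : ℕ} (hi : i ≤ T.length)
    (hp : p <+: T.drop i) (h1 : 1 ≤ c) (h2 : c ≤ σ) :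
    extendLeft σ T (intervalPair T p) c = some (intervalPair T (c :: p)) := by
  rw [extendLeft, if_pos ⟨h1, h2⟩, factorOf_intervalPair hi hp]; rfl

theorem contractRight_intervalPair {T p : List ℕ} {i : ℕ} (hi : i ≤ T.length)
    (hp : p <+: T.drop i) (h1 : p ≠ []) (h2 : LeftMaximal T p) :
    contractRight T (intervalPair T p) = some (intervalPair T p.dropLast) := by
  rw [contractRight, factorOf_intervalPair hi hp, Option.bind_some, if_pos ⟨h1, h2⟩]

theorem bwt_rank {T : List ℕ} {i : ℕ} (hi : i ≤ T.length) :
    bwt T (rank T i) = if i = 0 then 0 else T.getD (i - 1) 0 := by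
  rw [bwt, suffixPos_rank hi]

theorem intervalPair_fst_fst_le (T p : List ℕ) : (intervalPair T p).1.1 ≤ size T :=
  interval_fst_le T p

theorem intervalPair_fst_snd_le (T p : List ℕ) : (intervalPair T p).1.2 ≤ size T :=
  interval_snd_le T p

theorem size_reverse (T : List ℕ) : size T.reverse = size T := by simp [size]

theorem intervalPair_snd_fst_le (T p : List ℕ) : (intervalPair T p).2.1 ≤ size T := by
  rw [← size_reverse]; exact interval_fst_le T.reverse p.reverse

theorem intervalPair_snd_snd_le (T p : List ℕ) : (intervalPair T p).2.2 ≤ size T := by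
  rw [← size_reverse]; exact interval_snd_le T.reverse p.reverse

theorem intervalPair_nil (T : List ℕ) : intervalPair T [] = ((1, size T), (1, size T)) := by
  rw [intervalPair, List.reverse_nil, interval_nil, interval_nil, size_reverse]

end Intervals

/-! ### Combinatorics of the permuted lcp array: the test, the growth bound, left-maximality. -/

section Plcp

theorem le_lcp_iff {u v : List ℕ} {l : ℕ} (hl : l ≤ u.length) :
    l ≤ lcp u v ↔ u.take l <+: v := by
  induction u generalizing v l with
  | nil => obtain rfl : l = 0 := by simpa using hl
           simp
  | cons a u ih =>
    cases l with
    | zero => simp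
    | succ l =>
      cases v with
      | nil => simp [lcp]
      | cons b v =>
        rw [lcp, List.take_succ_cons, List.cons_prefix_cons]
        split_ifs with h
        · simp [h, ih (Nat.le_of_succ_le_succ hl)]
        · simp [h]

theorem lcp_le_length (u v : List ℕ) : lcp u v ≤ u.length := by
  induction u generalizing v with
  | nil => cases v <;> simp [lcp]
  | cons a u ih =>
    cases v with
    | nil => simp [lcp]
    | cons b v =>
      rw [lcp]
      split_ifs
      · simpa using ih v
      · simp

theorem plcp_le {T : List ℕ} {i : ℕ} (hi : i ≤ T.length) : plcp T i + i ≤ T.length := by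
  have := lcp_le_length (T.drop i) (T.drop (suffixPos T (rank T i - 1)))
  rw [List.length_drop] at this
  unfold plcp
  omega

/-- The scan starts at the empty suffix, which has no predecessor. Whatever the default lookup at
rank `0` gives, a common prefix with the empty string has length `0`. -/
theorem plcp_length (T : List ℕ) : plcp T T.length = 0 := by
  have := plcp_le (T := T) le_rfl
  omega

/-- The prefix of length `l` of suffix `i` also starts a smaller suffix if and only if
`l ≤ plcp T i`. -/
theorem interval_fst_lt_rank_iff {T : List ℕ} {i l : ℕ} (hi : i < T.length)
    (hl : i + l ≤ T.length) :
    (interval T ((T.drop i).take l)).1 < rank T i ↔ l ≤ plcp T i := by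
  have hp : (T.drop i).take l <+: T.drop i := List.take_prefix _ _
  have hs := interval_spec hi.le hp
  have h1 := one_lt_rank hi
  have h2 := rank_le hi.le
  have h3 := (prefix_drop_iff hi.le hp hi.le).1 hp
  rw [plcp, le_lcp_iff (by rw [List.length_drop]; omega),
    hs.2.2 (rank T i - 1) (by omega) (by omega)]
  omega

theorem interval_fst_lt_rank {T p : List ℕ} {i j : ℕ} (hi : i ≤ T.length)
    (hp : p <+: T.drop j) (hj : j ≤ T.length) (h : T.drop j < T.drop i) :
    (interval T p).1 < rank T i :=
  (interval_fst_le_rank hj hp).trans_lt (rank_lt_rank hj hi h)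

/-- The suffix before suffix `i` in the lexicographic order. -/
theorem exists_pred {T : List ℕ} {i : ℕ} (hi : i < T.length) :
    ∃ j ≤ T.length, T.drop j < T.drop i ∧ (T.drop i).take (plcp T i) <+: T.drop j := by
  have h1 := one_lt_rank hi
  have h2 := rank_le hi.le
  have h3 : suffixPos T (rank T i - 1) ≤ T.length := suffixPos_le (by omega) (by omega)
  refine ⟨suffixPos T (rank T i - 1), h3, drop_lt_of_rank_lt h3 hi.le ?_, ?_⟩
  · rw [rank_suffixPos (by omega) (by omega)]; omega
  · refine (le_lcp_iff ?_).1 le_rfl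
    have := plcp_le hi.le
    rw [List.length_drop]; omega

theorem drop_eq_cons {T : List ℕ} {i : ℕ} (hi : i < T.length) :
    T.drop i = T.getD i 0 :: T.drop (i + 1) := by
  rw [List.drop_eq_getElem_cons hi, List.getD_eq_getElem]

/-- If the entry is positive, suffix `i` and its predecessor share their first character. Deleting
it keeps their order and shortens the common prefix by one, so suffix `i + 1` has a smaller suffix
with that prefix. -/
theorem plcp_le_plcp_succ_add_one {T : List ℕ} {i : ℕ} (hi : i < T.length) :
    plcp T i ≤ plcp T (i + 1) + 1 := by
  obtain ⟨j, hj, hlt, hp⟩ := exists_pred hi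
  have hle := plcp_le hi.le
  cases hl : plcp T i with
  | zero => exact Nat.zero_le _
  | succ l =>
    rw [hl, drop_eq_cons hi, List.take_succ_cons] at hp
    have hj' : j < T.length := by
      by_contra h
      obtain rfl : j = T.length := by omega
      simp at hp
    rw [drop_eq_cons hj', List.cons_prefix_cons] at hp
    rw [drop_eq_cons hj', drop_eq_cons hi, List.cons_lt_cons_iff] at hlt
    have hlt' : T.drop (j + 1) < T.drop (i + 1) := by
      rcases hlt with h | h
      · omega
      · exact h.2
    -- Otherwise a suffix would be smaller than the empty one.
    have hi' : i + 1 < T.length := by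
      by_contra h
      rw [List.drop_eq_nil_of_le (not_lt.1 h)] at hlt'
      exact List.not_lt_nil _ hlt'
    have := (interval_fst_lt_rank_iff hi' (l := l) (by omega)).1
      (interval_fst_lt_rank hi'.le hp.2 (by omega) hlt')
    omega

/-- The leading marker shifts indices by one, so entry `j` of `0 :: T` is the character that
precedes text position `j`. -/
theorem cons_infix_cons_zero {T p : List ℕ} {j : ℕ} (hj : j ≤ T.length) (hp : p <+: T.drop j) :
    ((0 :: T).getD j 0 :: p) <:+: (0 :: T) := by
  refine List.infix_iff_prefix_suffix.2 ⟨(0 :: T).drop j, ?_, List.drop_suffix _ _⟩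
  rw [drop_eq_cons (T := 0 :: T) (by simpa [Nat.lt_succ_iff] using hj), List.drop_succ_cons]
  exact List.cons_prefix_cons.2 ⟨rfl, hp⟩

theorem getD_mem {T : List ℕ} {j : ℕ} (hj : j < T.length) : T.getD j 0 ∈ T := by
  rw [List.getD_eq_getElem (hn := hj)]; exact List.getElem_mem hj

/-- If `p` starts a suffix smaller than suffix `i + 1`, but its extension by the character at `i`
does not start a suffix smaller than suffix `i`, then `p` is left-maximal. -/
theorem leftMaximal_of_rank_le {T : List ℕ} (hT : ∀ c ∈ T, 1 ≤ c) {i l : ℕ}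
    (hi : i + 1 < T.length) (hl : l ≤ plcp T (i + 1))
    (h : rank T i ≤ (interval T (T.getD i 0 :: (T.drop (i + 1)).take l)).1) :
    LeftMaximal T ((T.drop (i + 1)).take l) := by
  obtain ⟨j, hj, hlt, hp⟩ := exists_pred hi
  replace hp : (T.drop (i + 1)).take l <+: T.drop j :=
    (List.take_prefix_take_left hl).trans hp
  have hi0 : i < T.length := by omega
  refine ⟨(0 :: T).getD j 0, getD_mem (by simpa [Nat.lt_succ_iff] using hj),
    (0 :: T).getD (i + 1) 0, getD_mem (by simpa using hi0), fun he => ?_,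
    cons_infix_cons_zero hj hp, cons_infix_cons_zero hi.le (List.take_prefix _ _)⟩
  rw [List.getD_cons_succ] at he
  cases j with
  -- The smaller occurrence is at the start of the text and is preceded by the marker, which differs
  -- from all characters.
  | zero =>
    have := hT _ (getD_mem hi0)
    rw [List.getD_cons_zero] at he
    omega
  | succ j =>
    rw [List.getD_cons_succ] at he
    -- Prepending the common character to both suffixes keeps their order, so the extension would
    -- start a suffix smaller than suffix `i`, against `h`.
    refine absurd (interval_fst_lt_rank (p := T.getD i 0 :: (T.drop (i + 1)).take l) hi0.le
      (j := j) ?_ (by omega) ?_) (not_lt.2 h)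
    · rw [drop_eq_cons (i := j) (by omega), he]
      exact List.cons_prefix_cons.2 ⟨rfl, hp⟩
    · rw [drop_eq_cons (i := j) (by omega), he, drop_eq_cons hi0]
      exact List.cons_lt_cons_iff.2 (Or.inr ⟨rfl, hlt⟩)

end Plcp

/-! ### The program and its registers. -/

section Program

/-- The registers that hold the pair of the current suffix. -/
def suffixRegs : PairRegs 22 := ⟨4, 5, 6, 7⟩

/-- The registers that hold the pair of the prefix that the current suffix shares with the
preceding one in lexicographic order. -/
def matchRegs : PairRegs 22 := ⟨8, 9, 10, 11⟩

/-- The registers that hold the pair of an extended match. -/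
def extendedRegs : PairRegs 22 := ⟨12, 13, 14, 15⟩

/-- The program that builds the permuted lcp array from right to left. Register `3` holds `1`,
register `19` holds `0`, register `16` the current character, and registers `17` and `18` hold the
cell and the offset of the current place in the bit vector. -/
def plcpProgram : List (Instr 22) :=
  [.const 3 1,
   .const 4 1,
   .op .add 5 0 19,
   .const 6 1,
   .op .add 7 0 19,
   .op .sub 17 0 3,
   .op .mod 18 17 1,
   .op .div 17 17 1,
   .op .add 17 17 17,
   .op .add 18 18 18,
   .jumpLt 18 1 13,
   .op .sub 18 18 1,
   .op .add 17 17 3,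
   .const 8 1,
   .op .add 9 0 19,
   .const 10 1,
   .op .add 11 0 19,
   -- 17: go to the preceding suffix
   .readBwt 16 4,
   .jumpEq 16 19 43,
   .extendLeft suffixRegs suffixRegs 16,
   -- 20: move the place one to the left, extend the match
   .jumpLt 19 18 23,
   .op .add 18 1 19,
   .op .sub 17 17 3,
   .op .sub 18 18 3,
   .extendLeft extendedRegs matchRegs 16,
   .jumpLt 12 4 34,
   .jumpEq 8 3 29,
   .contractRight matchRegs matchRegs,
   .jumpEq 19 19 20,
   -- 29: the match is empty and cannot be extended
   .jumpLt 19 18 32,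
   .op .add 18 1 19,
   .op .sub 17 17 3,
   .op .sub 18 18 3,
   .jumpEq 19 19 38,
   -- 34: the extended match is the new match
   .op .add 8 12 19,
   .op .add 9 13 19,
   .op .add 10 14 19,
   .op .add 11 15 19,
   -- 38: set the bit at the current place
   .op .shiftLeft 20 3 18,
   .load 21 17,
   .op .or 21 21 20,
   .store 17 21,
   .jumpEq 19 19 17]

end Program

/-! ### Symbolic execution of single instructions, the invariants, and the bit vector. -/

section Simulation

variable {w S σ t : ℕ} {T : List ℕ}

/-- The program halts from `s` with the permuted lcp array in memory, at cost at most `b`. -/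
def HaltsWithin (w S σ t : ℕ) (T : List ℕ) (s : State 22) (b : ℕ) : Prop :=
  ∃ τ s', Halts w S σ t T plcpProgram s τ s' ∧ HoldsPlcp w s'.mem T ∧ τ ≤ b

theorem HaltsWithin.mono {s : State 22} {b b' : ℕ} (h : HaltsWithin w S σ t T s b)
    (hb : b ≤ b') : HaltsWithin w S σ t T s b' := by
  obtain ⟨τ, s', h1, h2, h3⟩ := h
  exact ⟨τ, s', h1, h2, h3.trans hb⟩

/-- The program passes from `s` to `s'` at cost at most `c`, as far as bounds on the cost of halting
are concerned. -/
def Leads (w S σ t : ℕ) (T : List ℕ) (s : State 22) (c : ℕ) (s' : State 22) : Prop :=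
  ∀ b, HaltsWithin w S σ t T s' b → HaltsWithin w S σ t T s (c + b)

theorem Leads.trans {s s' s'' : State 22} {c c' : ℕ} (h : Leads w S σ t T s c s')
    (h' : Leads w S σ t T s' c' s'') : Leads w S σ t T s (c + c') s'' := by
  intro b hb
  rw [add_assoc]
  exact h _ (h' _ hb)

theorem Leads.mono {s s' : State 22} {c c' : ℕ} (h : Leads w S σ t T s c s') (hc : c ≤ c') :
    Leads w S σ t T s c' s' :=
  fun b hb => (h b hb).mono (by omega)

theorem Leads.haltsWithin {s s' : State 22} {c b b' : ℕ} (h : Leads w S σ t T s c s')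
    (h' : HaltsWithin w S σ t T s' b) (hb : c + b ≤ b') : HaltsWithin w S σ t T s b' :=
  (h b h').mono hb

theorem leads_of_exec {s s' : State 22} {i : Instr 22} (hi : plcpProgram[s.pc]? = some i)
    (he : i.exec w S σ T s = some s') : Leads w S σ t T s (i.cost t) s' := by
  rintro b ⟨τ, s₁, h1, h2, h3⟩
  exact ⟨_, s₁, .step i s s' s₁ τ hi he h1, h2, by omega⟩

variable {a x : ℕ} {r : Fin 22 → ℕ} {m : ℕ → ℕ}

theorem leads_const {d : Fin 22} {c v : ℕ} (hi : plcpProgram[a]? = some (.const d c))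
    (hv : c % 2 ^ w = v) :
    Leads w S σ t T ⟨a, r, m⟩ 1 ⟨a + 1, Function.update r d v, m⟩ := by
  subst hv
  exact leads_of_exec (s := ⟨a, r, m⟩) (i := .const d c) hi rfl

theorem leads_op {o : BinOp} {d y z : Fin 22} {v : ℕ}
    (hi : plcpProgram[a]? = some (.op o d y z)) (hv : o.eval w (r y) (r z) % 2 ^ w = v) :
    Leads w S σ t T ⟨a, r, m⟩ 1 ⟨a + 1, Function.update r d v, m⟩ := by
  subst hv
  exact leads_of_exec (s := ⟨a, r, m⟩) (i := .op o d y z) hi rfl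

theorem leads_load {d y : Fin 22} (hi : plcpProgram[a]? = some (.load d y)) (h : r y < S) :
    Leads w S σ t T ⟨a, r, m⟩ 1 ⟨a + 1, Function.update r d (m (r y) % 2 ^ w), m⟩ :=
  leads_of_exec (s := ⟨a, r, m⟩) (i := .load d y) hi (if_pos h)

theorem leads_store {y z : Fin 22} (hi : plcpProgram[a]? = some (.store y z)) (h : r y < S) :
    Leads w S σ t T ⟨a, r, m⟩ 1 ⟨a + 1, r, Function.update m (r y) (r z)⟩ :=
  leads_of_exec (s := ⟨a, r, m⟩) (i := .store y z) hi (if_pos h)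

theorem leads_jumpEq {y z : Fin 22} {l : ℕ} (hi : plcpProgram[a]? = some (.jumpEq y z l))
    (h : r y = r z) : Leads w S σ t T ⟨a, r, m⟩ 1 ⟨l, r, m⟩ :=
  leads_of_exec (s := ⟨a, r, m⟩) (i := .jumpEq y z l) hi (congrArg some (if_pos h))

theorem leads_jumpEq_next {y z : Fin 22} {l : ℕ} (hi : plcpProgram[a]? = some (.jumpEq y z l))
    (h : r y ≠ r z) : Leads w S σ t T ⟨a, r, m⟩ 1 ⟨a + 1, r, m⟩ :=
  leads_of_exec (s := ⟨a, r, m⟩) (i := .jumpEq y z l) hi (congrArg some (if_neg h))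

theorem leads_jumpLt {y z : Fin 22} {l : ℕ} (hi : plcpProgram[a]? = some (.jumpLt y z l))
    (h : r y < r z) : Leads w S σ t T ⟨a, r, m⟩ 1 ⟨l, r, m⟩ :=
  leads_of_exec (s := ⟨a, r, m⟩) (i := .jumpLt y z l) hi (congrArg some (if_pos h))

theorem leads_jumpLt_next {y z : Fin 22} {l : ℕ} (hi : plcpProgram[a]? = some (.jumpLt y z l))
    (h : ¬ r y < r z) : Leads w S σ t T ⟨a, r, m⟩ 1 ⟨a + 1, r, m⟩ :=
  leads_of_exec (s := ⟨a, r, m⟩) (i := .jumpLt y z l) hi (congrArg some (if_neg h))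

theorem leads_readBwt {d y : Fin 22} {v : ℕ} (hi : plcpProgram[a]? = some (.readBwt d y))
    (h1 : 1 ≤ r y) (h2 : r y ≤ size T) (hv : bwt T (r y) % 2 ^ w = v) :
    Leads w S σ t T ⟨a, r, m⟩ t ⟨a + 1, Function.update r d v, m⟩ := by
  subst hv
  exact leads_of_exec (s := ⟨a, r, m⟩) (i := .readBwt d y) hi (if_pos ⟨h1, h2⟩)

/-- The pair of intervals in four registers. -/
def pairAt (r : Fin 22 → ℕ) (q : PairRegs 22) : (ℕ × ℕ) × (ℕ × ℕ) :=
  ((r q.lo, r q.hi), (r q.lo', r q.hi'))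

/-- The registers after a pair of intervals is written. -/
def writePair (r : Fin 22 → ℕ) (q : PairRegs 22) (v : (ℕ × ℕ) × (ℕ × ℕ)) : Fin 22 → ℕ :=
  Function.update (Function.update (Function.update (Function.update r q.lo v.1.1) q.hi v.1.2)
    q.lo' v.2.1) q.hi' v.2.2

/-- Interval bounds never exceed `size T`, not even the default `(1, 0)`, so reduction to a word
changes nothing. -/
theorem setPair_intervalPair (hw : size T < 2 ^ w) (d : PairRegs 22) (p : List ℕ) :
    (State.setPair w ⟨a, r, m⟩ d (intervalPair T p)).next =
      ⟨a + 1, writePair r d (intervalPair T p), m⟩ := by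
  simp only [State.setPair, State.setReg, State.next, State.goto, writePair,
    Nat.mod_eq_of_lt ((intervalPair_fst_fst_le T p).trans_lt hw),
    Nat.mod_eq_of_lt ((intervalPair_fst_snd_le T p).trans_lt hw),
    Nat.mod_eq_of_lt ((intervalPair_snd_fst_le T p).trans_lt hw),
    Nat.mod_eq_of_lt ((intervalPair_snd_snd_le T p).trans_lt hw)]

theorem leads_extendLeft (hw : size T < 2 ^ w) {d q : PairRegs 22} {y : Fin 22} {p : List ℕ}
    {i c : ℕ} (hi : plcpProgram[a]? = some (.extendLeft d q y))
    (hq : pairAt r q = intervalPair T p) (hil : i ≤ T.length) (hp : p <+: T.drop i)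
    (hy : r y = c) (h1 : 1 ≤ c) (h2 : c ≤ σ) :
    Leads w S σ t T ⟨a, r, m⟩ t ⟨a + 1, writePair r d (intervalPair T (c :: p)), m⟩ := by
  refine leads_of_exec (i := .extendLeft d q y) hi ?_
  have e : State.getPair ⟨a, r, m⟩ q = intervalPair T p := hq
  have e' : State.reg ⟨a, r, m⟩ y = c := hy
  rw [Instr.exec, e, e', extendLeft_intervalPair hil hp h1 h2, Option.map_some,
    setPair_intervalPair hw]

theorem leads_contractRight (hw : size T < 2 ^ w) {d q : PairRegs 22} {p : List ℕ}
    {i : ℕ} (hi : plcpProgram[a]? = some (.contractRight d q))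
    (hq : pairAt r q = intervalPair T p) (hil : i ≤ T.length) (hp : p <+: T.drop i)
    (h1 : p ≠ []) (h2 : LeftMaximal T p) :
    Leads w S σ t T ⟨a, r, m⟩ t ⟨a + 1, writePair r d (intervalPair T p.dropLast), m⟩ := by
  refine leads_of_exec (i := .contractRight d q) hi ?_
  have e : State.getPair ⟨a, r, m⟩ q = intervalPair T p := hq
  rw [Instr.exec, e, contractRight_intervalPair hil hp h1 h2, Option.map_some,
    setPair_intervalPair hw]

/-- The registers hold the constants, the pairs of `s` and `p`, and the place `c`. -/
structure RegInv (w : ℕ) (T s p : List ℕ) (c : ℕ) (r : Fin 22 → ℕ) : Prop where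
  size_eq : r 0 = size T
  width_eq : r 1 = w
  one_eq : r 3 = 1
  zero_eq : r 19 = 0
  suffix_eq : pairAt r suffixRegs = intervalPair T s
  match_eq : pairAt r matchRegs = intervalPair T p
  place_eq : r 17 * w + r 18 = c
  offset_lt : r 18 < w

/-- The one-bits of the memory are those of the entries from `i` on. -/
def HoldsFrom (w : ℕ) (m : ℕ → ℕ) (T : List ℕ) (i : ℕ) : Prop :=
  ∀ x, memBit w m x = true ↔ ∃ j, i ≤ j ∧ j < T.length ∧ x = plcp T j + 2 * j

theorem plcp_add_strictMono {i j : ℕ} (hij : i < j) (hj : j ≤ T.length) :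
    plcp T i + 2 * i < plcp T j + 2 * j := by
  induction j, hij using Nat.le_induction with
  | base => have := plcp_le_plcp_succ_add_one (T := T) (i := i) (by omega)
            rw [Nat.succ_eq_add_one]; omega
  | succ j _ ih =>
    have := plcp_le_plcp_succ_add_one (T := T) (i := j) (by omega)
    have := ih (by omega)
    omega

/-- The places increase strictly with the position, so the one-bits before the place of `i` are
exactly those of the `i` earlier positions. -/
theorem HoldsFrom.holdsPlcp (h : HoldsFrom w m T 0) : HoldsPlcp w m T := by
  intro i hi
  refine ⟨(h _).2 ⟨i, Nat.zero_le _, hi, rfl⟩, ?_⟩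
  have : (Finset.range (plcp T i + 2 * i)).filter (fun x => memBit w m x = true) =
      (Finset.range i).image (fun j => plcp T j + 2 * j) := by
    ext x
    simp only [Finset.mem_filter, Finset.mem_range, Finset.mem_image, h x]
    constructor
    · rintro ⟨hx, j, -, hj, rfl⟩
      refine ⟨j, ?_, rfl⟩
      by_contra hij
      rcases (not_lt.1 hij).eq_or_lt with rfl | hij
      · omega
      · have := plcp_add_strictMono hij hj.le
        omega
    · rintro ⟨j, hj, rfl⟩
      exact ⟨plcp_add_strictMono hj hi.le, j, Nat.zero_le _, by omega, rfl⟩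
  rw [this, Finset.card_image_of_injOn, Finset.card_range]
  intro j hj k hk hjk
  have hj' : j < i := by simpa using hj
  have hk' : k < i := by simpa using hk
  dsimp only at hjk
  rcases lt_trichotomy j k with h | h | h
  · have := plcp_add_strictMono h (by omega : k ≤ T.length); omega
  · exact h
  · have := plcp_add_strictMono h (by omega : j ≤ T.length); omega

theorem HoldsFrom.update {i u v : ℕ} (h : HoldsFrom w m T (i + 1)) (hi : i < T.length)
    (huv : u * w + v = plcp T i + 2 * i) (hv : v < w) :
    HoldsFrom w (Function.update m u ((m u % 2 ^ w ||| (1 <<< v) % 2 ^ w) % 2 ^ w)) T i := by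
  intro x
  have hxw : x % w < w := Nat.mod_lt _ (by omega)
  have key : memBit w (Function.update m u ((m u % 2 ^ w ||| (1 <<< v) % 2 ^ w) % 2 ^ w)) x = true
      ↔ memBit w m x = true ∨ x = plcp T i + 2 * i := by
    have hx := Nat.div_add_mod' x w
    unfold memBit
    rw [← huv]
    by_cases hu : x / w = u
    · rw [hu, Function.update_self, Nat.one_shiftLeft]
      -- The reductions modulo `2 ^ w` are invisible here, since only bits at offsets below `w` are
      -- examined.
      simp only [Nat.testBit_mod_two_pow, Nat.testBit_or, Nat.testBit_two_pow, hxw, decide_true,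
        Bool.true_and, Bool.or_eq_true, decide_eq_true_eq]
      rw [hu] at hx
      constructor <;> rintro (h | h)
      · exact Or.inl h
      · exact Or.inr (by omega)
      · exact Or.inl h
      · exact Or.inr (by omega)
    · rw [Function.update_of_ne hu]
      refine ⟨Or.inl, fun h => h.resolve_right ?_⟩
      rintro rfl
      apply hu
      rw [mul_comm, Nat.mul_add_div (by omega), Nat.div_eq_of_lt hv, add_zero]
  rw [key, h x]
  constructor
  · rintro (⟨j, h1, h2, h3⟩ | h)
    · exact ⟨j, by omega, h2, h3⟩
    · exact ⟨i, le_rfl, hi, h⟩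
  · rintro ⟨j, h1, h2, h3⟩
    rcases h1.eq_or_lt with rfl | h1
    · exact Or.inr h3
    · exact Or.inl ⟨j, h1, h2, h3⟩

/-- A place can be as large as twice the text length and need not fit into a word, which is why cell
and offset are kept apart. The cell number fits: for `w ≥ 2` it is at most the text length, and for
`w = 1` the text is empty. -/
theorem cell_lt (hw : size T < 2 ^ w) {u v : ℕ} (h : u * w + v ≤ 2 * T.length) : u < 2 ^ w := by
  unfold size at hw
  rcases Nat.lt_or_ge w 2 with h2 | h2
  · have : (2 : ℕ) ^ w ≤ 2 ^ 1 := Nat.pow_le_pow_right (by norm_num) (by omega)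
    have hw0 : w ≠ 0 := by rintro rfl; simp at hw
    obtain rfl : w = 1 := by omega
    omega
  · have := Nat.mul_le_mul_left u h2
    omega

/-- Moving the place one to the left. -/
theorem leads_decrement (hw : size T < 2 ^ w) {s p : List ℕ} {c : ℕ}
    (h0 : plcpProgram[a]? = some (.jumpLt 19 18 (a + 3)))
    (h1 : plcpProgram[a + 1]? = some (.op .add 18 1 19))
    (h2 : plcpProgram[a + 2]? = some (.op .sub 17 17 3))
    (h3 : plcpProgram[a + 3]? = some (.op .sub 18 18 3))
    (hr : RegInv w T s p (c + 1) r) (hc : c + 1 ≤ 2 * T.length) :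
    ∃ r', Leads w S σ t T ⟨a, r, m⟩ 4 ⟨a + 4, r', m⟩ ∧ RegInv w T s p c r' ∧ r' 16 = r 16 := by
  obtain ⟨e0, e1, e3, e19, es, ep, epl, eo⟩ := hr
  have hwlt : w < 2 ^ w := Nat.lt_two_pow_self
  have h17 := cell_lt hw (epl.le.trans hc)
  by_cases hz : 0 < r 18
  · refine ⟨Function.update r 18 (r 18 - 1), ((leads_jumpLt h0 (by rwa [e19])).trans
      (leads_op h3 ?_)).mono (by norm_num), ?_, ?_⟩
    · rw [BinOp.eval, e3, show r 18 + 2 ^ w - 1 = (r 18 - 1) + 2 ^ w by omega, Nat.add_mod_right,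
        Nat.mod_eq_of_lt (by omega)]
    · constructor <;>
        simp_all [pairAt, suffixRegs, matchRegs] <;> omega
    · simp
  · have h180 : r 18 = 0 := by omega
    -- The offset is `0`, so a borrow from the cell number is needed; it is available because the
    -- place `c + 1` is positive.
    have h17' : 1 ≤ r 17 := by
      by_contra h
      have : r 17 = 0 := by omega
      rw [this, h180] at epl
      omega
    refine ⟨Function.update (Function.update (Function.update r 18 w) 17 (r 17 - 1)) 18 (w - 1),
      ((leads_jumpLt_next h0 (by rwa [e19])).trans ((leads_op (v := w) h1 ?_).trans
      ((leads_op (v := r 17 - 1) h2 ?_).trans (leads_op (v := w - 1) h3 ?_)))).mono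
        (by norm_num), ?_, ?_⟩
    · rw [BinOp.eval, e1, e19, add_zero, Nat.mod_eq_of_lt hwlt]
    · simp only [BinOp.eval, Function.update_apply, Fin.reduceEq, if_false, e3]
      rw [show r 17 + 2 ^ w - 1 = (r 17 - 1) + 2 ^ w by omega, Nat.add_mod_right,
        Nat.mod_eq_of_lt (by omega)]
    · simp only [BinOp.eval, Function.update_apply, Fin.reduceEq, if_false, if_true, e3]
      rw [show w + 2 ^ w - 1 = (w - 1) + 2 ^ w by omega, Nat.add_mod_right,
        Nat.mod_eq_of_lt (by omega)]
    · have : (r 17 - 1) * w + (w - 1) = c := by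
        obtain ⟨k, hk⟩ := Nat.exists_eq_add_of_le' h17'
        rw [hk, h180] at epl
        rw [hk, Nat.add_sub_cancel]
        rw [Nat.add_mul] at epl
        omega
      constructor <;>
        simp_all [pairAt, suffixRegs, matchRegs]
    · simp

end Simulation

/-! ### The loops of the program, with the place as potential. -/

section Loops

variable {w S σ t : ℕ} {T : List ℕ} {r : Fin 22 → ℕ} {m : ℕ → ℕ}

theorem plcp_add_le {i : ℕ} (hi : i ≤ T.length) : plcp T i + 2 * i ≤ 2 * T.length := by
  have := plcp_le hi
  omega

/-- Setting the bit at the current place. -/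
theorem leads_write (hS : 2 * T.length < S * w) {i : ℕ}
    {s p : List ℕ} (hi : i < T.length) (hr : RegInv w T s p (plcp T i + 2 * i) r)
    (hm : HoldsFrom w m T (i + 1)) :
    ∃ r' m', Leads w S σ t T ⟨38, r, m⟩ 5 ⟨17, r', m'⟩ ∧
      RegInv w T s p (plcp T i + 2 * i) r' ∧ HoldsFrom w m' T i := by
  have hm' := hm.update hi hr.place_eq hr.offset_lt
  obtain ⟨e0, e1, e3, e19, es, ep, epl, eo⟩ := hr
  have h17 : r 17 < S := by
    have := plcp_add_le hi.le
    refine lt_of_mul_lt_mul_right (a := w) ?_ (Nat.zero_le _)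
    omega
  refine ⟨_, _, ((leads_op (a := 38) (v := (1 <<< r 18) % 2 ^ w) rfl ?_).trans
    ((leads_load rfl ?_).trans
    ((leads_op (v := (m (r 17) % 2 ^ w ||| (1 <<< r 18) % 2 ^ w) % 2 ^ w) rfl ?_).trans
    ((leads_store rfl ?_).trans (leads_jumpEq rfl ?_))))).mono (by norm_num), ?_, ?_⟩
  · rw [BinOp.eval, e3]
  · simpa using h17
  · simp [BinOp.eval]
  · simpa using h17
  · simp
  · constructor <;> simp_all [pairAt, suffixRegs, matchRegs]
  · simpa using hm'

/-- Taking over the extended match. -/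
theorem leads_copy (hw : size T < 2 ^ w) {s p q : List ℕ} {c : ℕ}
    (hr : RegInv w T s p c r) (hq : pairAt r extendedRegs = intervalPair T q) :
    ∃ r', Leads w S σ t T ⟨34, r, m⟩ 4 ⟨38, r', m⟩ ∧ RegInv w T s q c r' := by
  obtain ⟨e0, e1, e3, e19, es, ep, epl, eo⟩ := hr
  have q1 := (intervalPair_fst_fst_le T q).trans_lt hw
  have q2 := (intervalPair_fst_snd_le T q).trans_lt hw
  have q3 := (intervalPair_snd_fst_le T q).trans_lt hw
  have q4 := (intervalPair_snd_snd_le T q).trans_lt hw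
  rw [← hq] at q1 q2 q3 q4
  simp only [pairAt, extendedRegs] at q1 q2 q3 q4
  refine ⟨_, ((leads_op (a := 34) (v := r 12) rfl ?_).trans ((leads_op (v := r 13) rfl ?_).trans
    ((leads_op (v := r 14) rfl ?_).trans (leads_op (v := r 15) rfl ?_)))).mono (by norm_num), ?_⟩
  · simpa [BinOp.eval, e19] using Nat.mod_eq_of_lt q1
  · simpa [BinOp.eval, e19] using Nat.mod_eq_of_lt q2
  · simpa [BinOp.eval, e19] using Nat.mod_eq_of_lt q3
  · simpa [BinOp.eval, e19] using Nat.mod_eq_of_lt q4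
  · constructor <;> simp_all [pairAt, suffixRegs, matchRegs, extendedRegs]

/-- Going to the preceding suffix. -/
theorem leads_outer (hT : ∀ c ∈ T, 1 ≤ c ∧ c ≤ σ) (hw : size T < 2 ^ w) (hσ : σ < 2 ^ w)
    (ht : 1 ≤ t) {i c : ℕ} (hi : i < T.length) {p : List ℕ}
    (hr : RegInv w T (T.drop (i + 1)) p c r) :
    ∃ r', Leads w S σ t T ⟨17, r, m⟩ (3 * t) ⟨20, r', m⟩ ∧ RegInv w T (T.drop i) p c r' ∧
      r' 16 = T.getD i 0 := by
  obtain ⟨e0, e1, e3, e19, es, ep, epl, eo⟩ := hr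
  have hc := hT _ (getD_mem hi)
  have e4 : r 4 = rank T (i + 1) := by
    rw [← interval_drop_fst hi]
    exact congrArg (fun x => x.1.1) es
  refine ⟨_, ((leads_readBwt (a := 17) (v := T.getD i 0) rfl ?_ ?_ ?_).trans
    ((leads_jumpEq_next rfl ?_).trans
    (leads_extendLeft hw (p := T.drop (i + 1)) (c := T.getD i 0) rfl ?_ hi
      (List.prefix_refl _) ?_ hc.1 hc.2))).mono
    (by omega), ?_, ?_⟩
  · rw [e4]; exact one_le_rank _ _
  · rw [e4]; exact rank_le hi
  · rw [e4, bwt_rank hi, if_neg (Nat.succ_ne_zero i), Nat.succ_sub_one,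
      Nat.mod_eq_of_lt (hc.2.trans_lt hσ)]
  · have := hc.1
    simp only [Function.update_self, ne_eq, Fin.reduceEq, not_false_eq_true,
      Function.update_of_ne, e19]
    omega
  · simpa [pairAt, suffixRegs] using es
  · simp
  · rw [← drop_eq_cons hi]
    constructor <;> simp_all [pairAt, suffixRegs, matchRegs, writePair]
  · simp [writePair, suffixRegs]

/-- Extending the match. -/
theorem leads_extend (hT : ∀ c ∈ T, 1 ≤ c ∧ c ≤ σ) (hw : size T < 2 ^ w) {i l c : ℕ}
    (hi : i < T.length)
    (hr : RegInv w T (T.drop i) ((T.drop (i + 1)).take l) (c + 1) r)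
    (hc : c + 1 ≤ 2 * T.length) (h16 : r 16 = T.getD i 0) :
    ∃ r', Leads w S σ t T ⟨20, r, m⟩ (4 + t) ⟨25, r', m⟩ ∧
      RegInv w T (T.drop i) ((T.drop (i + 1)).take l) c r' ∧ r' 16 = T.getD i 0 ∧
      pairAt r' extendedRegs = intervalPair T (T.getD i 0 :: (T.drop (i + 1)).take l) := by
  have hcT := hT _ (getD_mem hi)
  obtain ⟨r₁, h1, hr₁, h16₁⟩ := leads_decrement (S := S) (σ := σ) (t := t) (a := 20) (m := m) hw
    rfl rfl rfl rfl hr hc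
  refine ⟨_, h1.trans (leads_extendLeft hw rfl hr₁.match_eq (i := i + 1) hi
    (List.take_prefix _ _) (h16₁.trans h16) hcT.1 hcT.2), ?_, ?_, ?_⟩
  · obtain ⟨e0, e1, e3, e19, es, ep, epl, eo⟩ := hr₁
    constructor <;> simp_all [pairAt, suffixRegs, matchRegs, extendedRegs, writePair]
  · simp [writePair, extendedRegs, h16₁, h16]
  · simp [writePair, extendedRegs, pairAt]

theorem take_succ_drop {i l : ℕ} (hi : i < T.length) :
    T.getD i 0 :: (T.drop (i + 1)).take l = (T.drop i).take (l + 1) := by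
  rw [drop_eq_cons hi, List.take_succ_cons]

theorem take_eq_nil_iff_of_le {i l : ℕ} (hl : l + i ≤ T.length) :
    (T.drop i).take l = [] ↔ l = 0 := by
  rw [← List.length_eq_zero_iff, List.length_take, List.length_drop]
  omega

theorem dropLast_take_drop {i l : ℕ} (hl : l + 1 + i ≤ T.length) :
    ((T.drop i).take (l + 1)).dropLast = (T.drop i).take l := by
  rw [List.dropLast_eq_take, List.length_take, List.length_drop, List.take_take]
  congr 1
  omega

/-- Rank `1` belongs to the empty suffix, whose only prefix is the empty string. This replaces a
stored match length. -/
theorem interval_fst_eq_one_iff {p : List ℕ} {i : ℕ} (hi : i ≤ T.length) (hp : p <+: T.drop i) :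
    (interval T p).1 = 1 ↔ p = [] := by
  constructor
  · intro h
    have := ((prefix_drop_iff hi hp le_rfl).2 ?_)
    · simpa using this
    · have := (prefix_drop_iff hi hp hi).1 hp
      have := one_le_rank T i
      rw [rank_length, h]
      omega
  · rintro rfl
    rw [interval_nil]

/-- From the search for the match of suffix `i`, with a candidate of length `l`. The `ih` is what is
known for smaller places. -/
theorem haltsWithin_inner (hT : ∀ c ∈ T, 1 ≤ c ∧ c ≤ σ) (hw : size T < 2 ^ w) (ht : 1 ≤ t)
    (hS : 2 * T.length < S * w) {i l : ℕ} (hi : i < T.length) (hl : l ≤ plcp T (i + 1))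
    (hil : plcp T i ≤ l + 1)
    (hr : RegInv w T (T.drop i) ((T.drop (i + 1)).take l) (l + 2 * i + 2) r)
    (h16 : r 16 = T.getD i 0) (hm : HoldsFrom w m T (i + 1))
    (outer : ∀ r m, RegInv w T (T.drop i) ((T.drop i).take (plcp T i)) (plcp T i + 2 * i) r →
      HoldsFrom w m T i → HaltsWithin w S σ t T ⟨17, r, m⟩
        (20 * t * (plcp T i + 2 * i) + 3 * t))
    (inner : ∀ l' r, l = l' + 1 → plcp T i ≤ l' + 1 →
      RegInv w T (T.drop i) ((T.drop (i + 1)).take l') (l' + 2 * i + 2) r →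
      r 16 = T.getD i 0 → HaltsWithin w S σ t T ⟨20, r, m⟩ (20 * t * (l' + 2 * i + 2))) :
    HaltsWithin w S σ t T ⟨20, r, m⟩ (20 * t * (l + 2 * i + 2)) := by
  have hle := plcp_le (T := T) (i := i + 1) hi
  obtain ⟨r₁, h1, hr₁, h16₁, hq⟩ := leads_extend (S := S) (t := t) (m := m) hT hw
    (c := l + 2 * i + 1) hi hr (by omega) h16
  have e12 : r₁ 12 = (interval T (T.getD i 0 :: (T.drop (i + 1)).take l)).1 :=
    congrArg (fun x => x.1.1) hq
  have e4 : r₁ 4 = rank T i := by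
    rw [← interval_drop_fst hi.le]
    exact congrArg (fun x => x.1.1) hr₁.suffix_eq
  have e8 : r₁ 8 = (interval T ((T.drop (i + 1)).take l)).1 :=
    congrArg (fun x => x.1.1) hr₁.match_eq
  have hiff := interval_fst_lt_rank_iff hi (l := l + 1) (by omega)
  rw [← take_succ_drop hi] at hiff
  by_cases hlt : r₁ 12 < r₁ 4
  · have hpl : plcp T i = l + 1 := by
      rw [e12, e4, hiff] at hlt
      omega
    rw [take_succ_drop hi, ← hpl] at hq
    rw [show l + 2 * i + 1 = plcp T i + 2 * i by omega] at hr₁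
    obtain ⟨r₂, h2, hr₂⟩ := leads_copy (S := S) (σ := σ) (t := t) (m := m) hw hr₁ hq
    obtain ⟨r₃, m₃, h3, hr₃, hm₃⟩ := leads_write (S := S) (σ := σ) (t := t) hS hi hr₂ hm
    refine ((h1.trans (leads_jumpLt rfl hlt)).trans (h2.trans h3)).haltsWithin
      (outer r₃ m₃ hr₃ hm₃) ?_
    -- The `20 * t` of the abandoned place pays for the trial, the copy, the write, and the `3 * t`
    -- of the next step to a preceding suffix.
    rw [show l + 2 * i + 2 = plcp T i + 2 * i + 1 by omega, mul_add (20 * t) _ 1]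
    omega
  · have hpl : plcp T i ≤ l := by
      rw [e12, e4, hiff] at hlt
      omega
    by_cases h8 : r₁ 8 = r₁ 3
    · rw [hr₁.one_eq, e8, interval_fst_eq_one_iff hi (List.take_prefix _ _),
        take_eq_nil_iff_of_le (by omega)] at h8
      subst h8
      have hpl0 : plcp T i = 0 := by omega
      -- Even the single character fails, so the entry is `0`. The place is `2 * i + 1` after the
      -- trial and must move once more.
      obtain ⟨r₂, h2, hr₂, -⟩ := leads_decrement (S := S) (σ := σ) (t := t) (a := 29) (m := m) hw
        rfl rfl rfl rfl (c := plcp T i + 2 * i) (hpl0 ▸ hr₁) (by omega)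
      obtain ⟨r₃, m₃, h3, hr₃, hm₃⟩ := leads_write (S := S) (σ := σ) (t := t) hS hi hr₂ hm
      refine ((h1.trans (leads_jumpLt_next rfl hlt)).trans ((leads_jumpEq rfl ?_).trans
        ((h2.trans (leads_jumpEq rfl rfl)).trans h3))).haltsWithin
        (outer r₃ m₃ ?_ hm₃) ?_
      · rw [hr₁.one_eq, e8, List.take_zero, interval_nil]
      · rw [hpl0] at hr₃ ⊢
        simpa using hr₃
      · rw [show 0 + 2 * i + 2 = plcp T i + 2 * i + 2 by omega, mul_add (20 * t) _ 2]
        omega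
    · have hne : (T.drop (i + 1)).take l ≠ [] := by
        intro h
        rw [hr₁.one_eq, e8, h, interval_nil] at h8
        exact h8 rfl
      have hl0 : l ≠ 0 := by rintro rfl; exact hne List.take_zero
      obtain ⟨l', rfl⟩ := Nat.exists_eq_succ_of_ne_zero hl0
      -- The failed test is precisely what makes the contraction a defined query.
      have hmax : LeftMaximal T ((T.drop (i + 1)).take l'.succ) :=
        leftMaximal_of_rank_le (fun c hc => (hT c hc).1) (by omega) hl (by
          rw [← e12, ← e4]; exact not_lt.1 hlt)
      refine ((h1.trans (leads_jumpLt_next rfl hlt)).trans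
        ((leads_jumpEq_next rfl h8).trans
        ((leads_contractRight hw rfl hr₁.match_eq (i := i + 1) hi (List.take_prefix _ _) hne
          hmax).trans (leads_jumpEq rfl rfl)))).haltsWithin
        (inner l' _ rfl (by omega) ?_ ?_) ?_
      · rw [Nat.succ_eq_add_one, dropLast_take_drop (by omega)]
        obtain ⟨e0, e1, e3, e19, es, ep, epl, eo⟩ := hr₁
        constructor <;> simp_all [pairAt, suffixRegs, matchRegs, writePair] <;> omega
      · simp [writePair, matchRegs, h16₁]
      · rw [show l'.succ + 2 * i + 2 = (l' + 2 * i + 2) + 1 by omega,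
          mul_add (20 * t) (l' + 2 * i + 2) 1]
        omega

/-- Strong induction on the place. A trial strictly lowers it, so the first claim uses both claims
at smaller places. Going to the preceding suffix leaves it unchanged, so the second claim uses the
first at the same place and has `3 * t` extra in its budget. -/
theorem haltsWithin_place (hT : ∀ c ∈ T, 1 ≤ c ∧ c ≤ σ) (hw : size T < 2 ^ w)
    (hσ : σ < 2 ^ w) (ht : 1 ≤ t) (hS : 2 * T.length < S * w) (c : ℕ) :
    (∀ i l r m, i < T.length → l ≤ plcp T (i + 1) → plcp T i ≤ l + 1 → c = l + 2 * i + 2 →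
      RegInv w T (T.drop i) ((T.drop (i + 1)).take l) c r → r 16 = T.getD i 0 →
      HoldsFrom w m T (i + 1) → HaltsWithin w S σ t T ⟨20, r, m⟩ (20 * t * c)) ∧
    (∀ i r m, i ≤ T.length → c = plcp T i + 2 * i →
      RegInv w T (T.drop i) ((T.drop i).take (plcp T i)) c r → HoldsFrom w m T i →
      HaltsWithin w S σ t T ⟨17, r, m⟩ (20 * t * c + 3 * t)) := by
  induction c using Nat.strong_induction_on with
  | _ c ih =>
    have inner : ∀ i l r m, i < T.length → l ≤ plcp T (i + 1) → plcp T i ≤ l + 1 →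
        c = l + 2 * i + 2 → RegInv w T (T.drop i) ((T.drop (i + 1)).take l) c r →
        r 16 = T.getD i 0 → HoldsFrom w m T (i + 1) →
        HaltsWithin w S σ t T ⟨20, r, m⟩ (20 * t * c) := by
      rintro i l r m hi hl hil rfl hr h16 hm
      refine haltsWithin_inner hT hw ht hS hi hl hil hr h16 hm ?_ ?_
      · intro r' m' hr' hm'
        exact (ih _ (by omega)).2 i r' m' hi.le rfl hr' hm'
      · rintro l' r' rfl hil' hr' h16'
        exact (ih _ (by omega)).1 i l' r' m hi (by omega) hil' rfl hr' h16' hm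
    refine ⟨inner, ?_⟩
    rintro i r m hi rfl hr hm
    cases i with
    -- The BWT entry of the whole text is the marker, equal to register `19`; the jump leaves the
    -- program.
    | zero =>
      obtain ⟨e0, e1, e3, e19, es, ep, epl, eo⟩ := hr
      have e4 : r 4 = rank T 0 := by
        rw [← interval_drop_fst hi]
        exact congrArg (fun x => x.1.1) es
      refine ((leads_readBwt (a := 17) (v := 0) rfl ?_ ?_ ?_).trans
        (leads_jumpEq rfl ?_)).haltsWithin (b := 0) ?_ (by omega)
      · rw [e4]; exact one_le_rank _ _
      · rw [e4]; exact rank_le hi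
      · rw [e4, bwt_rank hi, if_pos rfl, Nat.zero_mod]
      · simp [e19]
      · exact ⟨0, _, .halt _ le_rfl, hm.holdsPlcp, le_rfl⟩
    | succ i =>
      obtain ⟨r', h, hr', h16⟩ := leads_outer (S := S) (m := m) hT hw hσ ht hi hr
      refine h.haltsWithin (inner i _ r' m hi le_rfl (plcp_le_plcp_succ_add_one hi) ?_ hr' h16 hm)
        ?_
      · omega
      · omega

/-- Setting the registers up for the empty suffix. -/
theorem leads_start (hw : size T < 2 ^ w) :
    ∃ r, Leads w S σ t T (State.init 22 w σ T) 17 ⟨17, r, fun _ => 0⟩ ∧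
      RegInv w T (T.drop T.length) ((T.drop T.length).take (plcp T T.length))
        (plcp T T.length + 2 * T.length) r := by
  have hsz : size T = T.length + 1 := rfl
  have hw0 : 0 < w := by
    rcases Nat.eq_zero_or_pos w with rfl | h
    · simp [hsz] at hw
    · exact h
  have hwlt : w < 2 ^ w := Nat.lt_two_pow_self
  have hw2 : 2 * w ≤ 2 ^ w := by
    obtain ⟨v, rfl⟩ := Nat.exists_eq_add_of_le' hw0
    have : v < 2 ^ v := Nat.lt_two_pow_self
    rw [pow_succ]
    omega
  have h1 : 1 % 2 ^ w = 1 := Nat.mod_eq_of_lt (by omega)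
  have hn : size T % 2 ^ w = size T := Nat.mod_eq_of_lt hw
  have hdm := Nat.div_add_mod' T.length w
  have hml := Nat.mod_lt T.length hw0
  set u := T.length / w with hu
  set v := T.length % w with hv
  have huu : u + u < 2 ^ w := by
    refine cell_lt hw (v := 0) ?_
    rw [add_mul]
    omega
  have hum : u ≤ T.length := Nat.div_le_self _ _
  let r₀ : Fin 22 → ℕ := (State.init 22 w σ T).reg
  have a0 : r₀ 0 = size T := rfl
  have a1 : r₀ 1 = w := rfl
  have a19 : r₀ 19 = 0 := rfl
  obtain ⟨r₁, l1, b0, b1, b3, b4, b5, b6, b7, b19, b17, b18⟩ : ∃ r₁,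
      Leads w S σ t T (State.init 22 w σ T) 10 ⟨10, r₁, fun _ => 0⟩ ∧ r₁ 0 = size T ∧ r₁ 1 = w ∧
      r₁ 3 = 1 ∧ r₁ 4 = 1 ∧ r₁ 5 = size T ∧ r₁ 6 = 1 ∧ r₁ 7 = size T ∧ r₁ 19 = 0 ∧
      r₁ 17 = u + u ∧ r₁ 18 = v + v := by
    refine ⟨_, ((leads_const (a := 0) (r := r₀) (v := 1) rfl ?_).trans
      ((leads_const (v := 1) rfl ?_).trans
      ((leads_op (v := size T) rfl ?_).trans
      ((leads_const (v := 1) rfl ?_).trans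
      ((leads_op (v := size T) rfl ?_).trans
      ((leads_op (v := T.length) rfl ?_).trans
      ((leads_op (v := v) rfl ?_).trans
      ((leads_op (v := u) rfl ?_).trans
      ((leads_op (v := u + u) rfl ?_).trans
      (leads_op (v := v + v) rfl ?_)))))))))).mono (by norm_num), ?_⟩
    · exact h1
    · exact h1
    · simp [BinOp.eval, a0, a19, hn]
    · exact h1
    · simp [BinOp.eval, a0, a19, hn]
    · simp only [BinOp.eval, Function.update_self, ne_eq, Fin.reduceEq, not_false_eq_true,
        Function.update_of_ne, a0]
      rw [show size T + 2 ^ w - 1 = T.length + 2 ^ w by omega, Nat.add_mod_right,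
        Nat.mod_eq_of_lt (by omega)]
    · simp only [BinOp.eval, Function.update_self, ne_eq, Fin.reduceEq, not_false_eq_true,
        Function.update_of_ne, a1]
      exact Nat.mod_eq_of_lt (by omega)
    · simp only [BinOp.eval, Function.update_self, ne_eq, Fin.reduceEq, not_false_eq_true,
        Function.update_of_ne, a1]
      exact Nat.mod_eq_of_lt (by omega)
    · simp only [BinOp.eval, Function.update_self]
      exact Nat.mod_eq_of_lt huu
    · simp only [BinOp.eval, Function.update_self, ne_eq, Fin.reduceEq, not_false_eq_true,
        Function.update_of_ne]
      exact Nat.mod_eq_of_lt (by omega)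
    · simp [a0, a1, a19]
  obtain ⟨r₂, l2, c17, c18, hc⟩ : ∃ r₂,
      Leads w S σ t T ⟨10, r₁, fun _ => 0⟩ 3 ⟨13, r₂, fun _ => 0⟩ ∧
      r₂ 17 * w + r₂ 18 = 2 * T.length ∧ r₂ 18 < w ∧
      ∀ x, x ≠ 17 → x ≠ 18 → r₂ x = r₁ x := by
    -- Doubling quotient and remainder of the text length yields the place `2 * T.length` without
    -- forming that number; the doubled remainder may carry once into the cell number.
    by_cases hlt : r₁ 18 < r₁ 1
    · refine ⟨r₁, (leads_jumpLt rfl hlt).mono (by norm_num), ?_, by omega, fun _ _ _ => rfl⟩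
      rw [b17, b18, add_mul]
      omega
    · rw [b18, b1] at hlt
      refine ⟨_, ((leads_jumpLt_next rfl (by rwa [b18, b1])).trans
        ((leads_op (v := v + v - w) rfl ?_).trans
        (leads_op (v := u + u + 1) rfl ?_))).mono (by norm_num), ?_, ?_, ?_⟩
      · rw [BinOp.eval, b18, b1, show v + v + 2 ^ w - w = (v + v - w) + 2 ^ w by omega,
          Nat.add_mod_right, Nat.mod_eq_of_lt (by omega)]
      · simp only [BinOp.eval, ne_eq, Fin.reduceEq, not_false_eq_true,
          Function.update_of_ne, b17, b3]
        refine Nat.mod_eq_of_lt (cell_lt hw (v := 0) ?_)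
        rw [add_mul, add_mul]
        omega
      · simp only [Function.update_self, ne_eq, Fin.reduceEq, not_false_eq_true,
          Function.update_of_ne]
        rw [add_mul, add_mul]
        omega
      · simp only [Function.update_self, ne_eq, Fin.reduceEq, not_false_eq_true,
          Function.update_of_ne]
        omega
      · intro x h17 h18
        rw [Function.update_of_ne h17, Function.update_of_ne h18]
  have c0 := (hc 0 (by decide) (by decide)).trans b0
  have c1 := (hc 1 (by decide) (by decide)).trans b1
  have c3 := (hc 3 (by decide) (by decide)).trans b3
  have c4 := (hc 4 (by decide) (by decide)).trans b4
  have c5 := (hc 5 (by decide) (by decide)).trans b5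
  have c6 := (hc 6 (by decide) (by decide)).trans b6
  have c7 := (hc 7 (by decide) (by decide)).trans b7
  have c19 := (hc 19 (by decide) (by decide)).trans b19
  refine ⟨_, (l1.trans (l2.trans
    ((leads_const (v := 1) rfl ?_).trans
    ((leads_op (v := size T) rfl ?_).trans
    ((leads_const (v := 1) rfl ?_).trans
    (leads_op (v := size T) rfl ?_)))))).mono (by norm_num), ?_⟩
  · exact h1
  · simp [BinOp.eval, c0, c19, hn]
  · exact h1
  · simp [BinOp.eval, c0, c19, hn]
  · rw [plcp_length, List.drop_length, List.take_nil, zero_add]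
    constructor <;> simp_all [pairAt, suffixRegs, matchRegs, intervalPair_nil]

end Loops

end TextIndex

/-! ### The lemma with its constants. -/

theorem mainTheorem7 :
    ∃ (k : ℕ) (P : List (TextIndex.Instr k)), ∀ C : ℕ, ∃ K : ℕ,
      ∀ (w σ t : ℕ) (T : List ℕ),
        (∀ c ∈ T, 1 ≤ c ∧ c ≤ σ) →
        1 ≤ t →
        TextIndex.size T < 2 ^ w →
        σ < 2 ^ w →
        w ≤ C * (Nat.log 2 (TextIndex.size T) + 1) →
        ∃ (S τ : ℕ) (s : TextIndex.State k),
          TextIndex.Halts w S σ t T P (TextIndex.State.init k w σ T) τ s ∧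
          TextIndex.HoldsPlcp w s.mem T ∧
          τ ≤ K * (t * TextIndex.size T) ∧
          (k + S) * w ≤ K * TextIndex.size T := by
  -- The time is at most `17 + 40 * t * T.length + 3 * t`. The `22` registers and `2 * T.length / w
  -- + 1` cells take at most `23 * w + 2 * T.length` bits, where `w` is at most `C * size T`.
  refine ⟨22, TextIndex.plcpProgram, fun C => ⟨60 + 23 * C, ?_⟩⟩
  intro w σ t T hT ht hw hσ hC
  have hsz : TextIndex.size T = T.length + 1 := rfl
  have hw0 : 0 < w := by
    rcases Nat.eq_zero_or_pos w with rfl | h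
    · simp [hsz] at hw
    · exact h
  have hlog : Nat.log 2 (TextIndex.size T) < TextIndex.size T :=
    Nat.log_lt_self 2 (by omega)
  have hwn : w ≤ C * TextIndex.size T := hC.trans (Nat.mul_le_mul_left C hlog)
  have hS : 2 * T.length < (2 * T.length / w + 1) * w := by
    rw [mul_comm _ w]
    exact Nat.lt_mul_div_succ _ hw0
  obtain ⟨r, h, hr⟩ := TextIndex.leads_start (S := 2 * T.length / w + 1) (σ := σ) (t := t) hw
  have hm : TextIndex.HoldsFrom w (fun _ => 0) T T.length := by
    intro x
    simp only [TextIndex.memBit, Nat.zero_testBit, Bool.false_eq_true, false_iff]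
    rintro ⟨j, h1, h2, -⟩
    omega
  obtain ⟨τ, s, h1, h2, h3⟩ := h _ ((TextIndex.haltsWithin_place hT hw hσ ht hS _).2
    T.length r _ le_rfl rfl hr hm)
  refine ⟨2 * T.length / w + 1, τ, s, h1, h2, h3.trans ?_, ?_⟩
  · rw [TextIndex.plcp_length, hsz]
    nlinarith [Nat.zero_le (t * T.length), Nat.zero_le (C * (t * (T.length + 1)))]
  · have h4 : 2 * T.length / w * w ≤ 2 * T.length := Nat.div_mul_le_self _ _
    rw [hsz] at hwn ⊢
    nlinarith
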